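/- Let $\mathcal H_A,\mathcal H_B$ be nonzero finite-dimensional complex Hilbert spaces, $d=\dim\mathcal H_B$, and let $N\ge 1$. An operator on $\mathcal H_A\otimes\mathcal H_B$ is separable if it equals a finite sum $\sum_i p_i|u_i\rangle\langle u_i|\otimes|v_i\rangle\langle v_i|$ with $p_i\ge 0$ and unit vectors $u_i\in\mathcal H_A$, $v_i\in\mathcal H_B$. An $N$ Bose symmetric extension of a positive semidefinite operator $\Lambda_{AB}$ is a positive semidefinite operator $\Lambda_{AB^N}$ on $\mathcal H_A\otimes\mathcal H_B^{\otimes N}$ with $\mathrm{tr}_{B^{N-1}}(\Lambda_{AB^N})=\Lambda_{AB}$ (all copies of $B$ but the first are traced out) and $\Lambda_{AB^N}(\mathbb I_A\otimes P^N_{\mathrm{sym}})=\Lambda_{AB^N}$, where $P^N_{\mathrm{sym}}$ is the projector onto the symmetric subspace of $\mathcal H_B^{\otimes N}$. Let $S^N$ be the set of positive semidefinite $\Lambda_{AB}$ that have such an extension, and $\bar S^N$ the set of those of trace one. Write $\Lambda_A=\mathrm{tr}_B\Lambda_{AB}$. For a state $\rho_{AB}$ let $p_c(\rho_{AB})$ be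 the minimum of the $p\in[0,1]$ for which $(\mathrm{id}_A\otimes\Omega^{(p)})(\rho_{AB})$ is a separable state, where $\Omega^{(p)}(X)=(1-p)X+p\,\mathrm{tr}(X)\,\mathbb I_B/d$, and for a set $W$ of states let $p_c(W)=\sup_{\rho\in W}p_c(\rho)$. Theorem. 1. For $\rho\in\bar S^N$ the minimum defining $p_c(\rho)$ is attained, and $p_c(\bar S^N)\le\frac{d}{N+d}$. 2. In other words: for every $\Lambda_{AB}\in S^N$ the operator $$\tilde\Lambda_{AB}=\frac{N}{N+d}\Lambda_{AB}+\frac{1}{N+d}\Lambda_A\otimes\mathbb I_B$$ is separable. 3. A separable decomposition is obtained by measuring $B^N$ with a Haar-random measurement and preparing its outcome: fix a unit vector $|0\rangle\in\mathcal H_B$, write $|U\rangle=U|0\rangle$ for a unitary $U$ of $\mathcal H_B$, let $dU$ be the Haar probability measure and $M_U=\binom{N+d-1}{N}|U\rangle\langle U|^{\otimes N}\ge 0$. Then $\int M_U\,dU=P^N_{\mathrm{sym}}$, and for every $N$ Bose symmetric extension $\Lambda_{AB^N}$ of $\Lambda_{AB}$ the operators $\mathrm{tr}_{B^N}\big((\mathbb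 I_A\otimes M_U)\Lambda_{AB^N}\big)$ are positive semidefinite and $$\tilde\Lambda_{AB}=\int \mathrm{tr}_{B^N}\big((\mathbb I_A\otimes M_U)\Lambda_{AB^N}\big)\otimes|U\rangle\langle U|\,dU .$$ -/

import Mathlib

open Matrix MeasureTheory
open scoped ComplexOrder Kronecker

noncomputable section

namespace BoseExt

/-- The rank-one operator `|v⟩⟨v|`. -/
def proj {m : Type*} (v : m → ℂ) : Matrix m m ℂ := vecMulVec v (star v)

/-- Unit vectors of the Hilbert space `ℂ^m`. -/
def IsUnitVec {m : Type*} [Fintype m] (v : m → ℂ) : Prop := star v ⬝ᵥ v = 1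

/-- Separable operators on `ℂ^A ⊗ ℂ^B`:
`Λ = ∑ i, p i |u i⟩⟨u i| ⊗ |v i⟩⟨v i|` with `p i ≥ 0` and unit vectors `u i`, `v i`. -/
def IsSeparable {A B : Type*} [Fintype A] [Fintype B]
    (Λ : Matrix (A × B) (A × B) ℂ) : Prop :=
  ∃ (n : ℕ) (p : Fin n → ℝ) (u : Fin n → A → ℂ) (v : Fin n → B → ℂ),
    (∀ i, 0 ≤ p i) ∧ (∀ i, IsUnitVec (u i)) ∧ (∀ i, IsUnitVec (v i)) ∧
      Λ = ∑ i, p i • (proj (u i) ⊗ₖ proj (v i))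

/-- The set of separable states (separable operators of trace one). -/
def sepStates (A B : Type*) [Fintype A] [Fintype B] : Set (Matrix (A × B) (A × B) ℂ) :=
  {ρ | IsSeparable ρ ∧ ρ.trace = 1}

/-- The partial trace over the second factor. -/
def ptraceRight {A C : Type*} [Fintype C] (Λ : Matrix (A × C) (A × C) ℂ) : Matrix A A ℂ :=
  of fun a a' => ∑ c, Λ (a, c) (a', c)

/-- The block `⟨a| Λ |a'⟩` of a bipartite operator: an operator on the second factor. -/
def block {A C : Type*} (Λ : Matrix (A × C) (A × C) ℂ) (a a' : A) : Matrix C C ℂ :=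
  of fun c c' => Λ (a, c) (a', c')

/-- The action `id_A ⊗ T` of a map `T` on the second factor. -/
def applyRight {A B : Type*} (T : Matrix B B ℂ → Matrix B B ℂ)
    (Λ : Matrix (A × B) (A × B) ℂ) : Matrix (A × B) (A × B) ℂ :=
  of fun i j => T (block Λ i.1 j.1) i.2 j.2

/-- The depolarizing channel `X ↦ (1 - p) X + p tr(X) 𝕀 / d`, where `d = dim`. -/
def depolarize {B : Type*} [Fintype B] [DecidableEq B] (p : ℝ) (X : Matrix B B ℂ) :
    Matrix B B ℂ :=
  (1 - p) • X + p • ((X.trace / (Fintype.card B : ℂ)) • (1 : Matrix B B ℂ))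

/-- The probabilities `p` for which depolarizing the second party with probability `p`
turns `ρ` into a separable state. -/
def disentanglingProbs {A B : Type*} [Fintype A] [Fintype B] [DecidableEq B]
    (ρ : Matrix (A × B) (A × B) ℂ) : Set ℝ :=
  {p | 0 ≤ p ∧ p ≤ 1 ∧ applyRight (depolarize p) ρ ∈ sepStates A B}

/-- The critical disentangling probability of a state. -/
def criticalProb {A B : Type*} [Fintype A] [Fintype B] [DecidableEq B]
    (ρ : Matrix (A × B) (A × B) ℂ) : ℝ :=
  sInf (disentanglingProbs ρ)

/-- The critical disentangling probability of a set of states. -/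
def criticalProbSet {A B : Type*} [Fintype A] [Fintype B] [DecidableEq B]
    (W : Set (Matrix (A × B) (A × B) ℂ)) : ℝ :=
  sSup (criticalProb '' W)

/-- The operator on `(ℂ^B)^{⊗N}` permuting the tensor factors by `π`; the product basis of
`(ℂ^B)^{⊗N}` is indexed by `Fin N → B`. -/
def permOp {B : Type*} [DecidableEq B] {N : ℕ} (π : Equiv.Perm (Fin N)) :
    Matrix (Fin N → B) (Fin N → B) ℂ :=
  of fun x y => if x = y ∘ π.symm then 1 else 0

/-- The projector onto the symmetric subspace of `(ℂ^B)^{⊗N}`. -/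
def symProj (B : Type*) [DecidableEq B] (N : ℕ) : Matrix (Fin N → B) (Fin N → B) ℂ :=
  ((N.factorial : ℂ)⁻¹) • ∑ π : Equiv.Perm (Fin N), permOp π

/-- The partial trace over all copies of `B` but the first one. -/
def reduceFirst {A B : Type*} [Fintype B] [DecidableEq B] {N : ℕ} [NeZero N]
    (Ω : Matrix (A × (Fin N → B)) (A × (Fin N → B)) ℂ) : Matrix (A × B) (A × B) ℂ :=
  of fun i j => ∑ x : Fin N → B,
    if x 0 = i.2 then Ω (i.1, x) (j.1, Function.update x 0 j.2) else 0

/-- `Ω` is an `N` Bose symmetric extension of `Λ`. -/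
structure IsBSE {A B : Type*} [Fintype A] [DecidableEq A] [Fintype B] [DecidableEq B]
    (N : ℕ) [NeZero N] (Λ : Matrix (A × B) (A × B) ℂ)
    (Ω : Matrix (A × (Fin N → B)) (A × (Fin N → B)) ℂ) : Prop where
  posSemidef : Ω.PosSemidef
  reduce : reduceFirst Ω = Λ
  symmetric : Ω * ((1 : Matrix A A ℂ) ⊗ₖ symProj B N) = Ω

/-- The cone `S^N` of non-negative operators that have an `N` Bose symmetric extension. -/
def extendible (A B : Type*) [Fintype A] [DecidableEq A] [Fintype B] [DecidableEq B]
    (N : ℕ) [NeZero N] : Set (Matrix (A × B) (A × B) ℂ) :=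
  {Λ | Λ.PosSemidef ∧ ∃ Ω, IsBSE N Λ Ω}

/-- The states (operators of trace one) in `S^N`. -/
def extendibleStates (A B : Type*) [Fintype A] [DecidableEq A] [Fintype B] [DecidableEq B]
    (N : ℕ) [NeZero N] : Set (Matrix (A × B) (A × B) ℂ) :=
  {ρ | ρ ∈ extendible A B N ∧ ρ.trace = 1}

/-- The operator `N/(N+d) Λ + 1/(N+d) Λ_A ⊗ 𝕀_B`, where `d = dim H_B`. -/
def noisy {A B : Type*} [Fintype B] [DecidableEq B] (N : ℕ)
    (Λ : Matrix (A × B) (A × B) ℂ) : Matrix (A × B) (A × B) ℂ :=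
  ((N : ℝ) / (N + Fintype.card B)) • Λ +
    ((1 : ℝ) / (N + Fintype.card B)) • (ptraceRight Λ ⊗ₖ (1 : Matrix B B ℂ))

instance compactSpace_unitaryGroup (B : Type*) [Fintype B] [DecidableEq B] :
    CompactSpace (unitaryGroup B ℂ) := by
  refine (isCompact_iff_compactSpace (s := (unitary (Matrix B B ℂ) : Set (Matrix B B ℂ)))).mp ?_
  have hK : IsCompact (Set.pi Set.univ fun _ : B => Set.pi Set.univ fun _ : B =>
      Metric.closedBall (0 : ℂ) 1) :=
    isCompact_univ_pi fun _ => isCompact_univ_pi fun _ => isCompact_closedBall _ _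
  refine hK.of_isClosed_subset (isClosed_unitary (R := Matrix B B ℂ)) ?_
  intro U hU i _ j _
  simpa using entry_norm_bound_of_unitary hU i j

instance measurableSpace_unitaryGroup (B : Type*) [Fintype B] [DecidableEq B] :
    MeasurableSpace (unitaryGroup B ℂ) := borel _

instance borelSpace_unitaryGroup (B : Type*) [Fintype B] [DecidableEq B] :
    BorelSpace (unitaryGroup B ℂ) := ⟨rfl⟩

/-- The Haar probability measure of the unitary group of `ℂ^B`
(the Haar measure that gives the whole group mass one). -/
def haarUnitary (B : Type*) [Fintype B] [DecidableEq B] : Measure (unitaryGroup B ℂ) :=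
  Measure.haarMeasure ⊤

/-- The vector `|U⟩ = U|φ⟩`, where `|φ⟩` is a fixed reference vector. -/
def ketU {B : Type*} [Fintype B] [DecidableEq B] (φ : B → ℂ) (U : unitaryGroup B ℂ) : B → ℂ :=
  (U : Matrix B B ℂ) *ᵥ φ

/-- The vector `|v⟩^{⊗N}`. -/
def tensorPow {B : Type*} (N : ℕ) (v : B → ℂ) : (Fin N → B) → ℂ := fun x => ∏ k, v (x k)

/-- The density, with respect to the Haar probability measure, of the measurement
`|U⟩⟨U|^{⊗N} dU`, normalized by the dimension `(N+d-1 choose N)` of the symmetric subspace. -/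
def haarPOVM {B : Type*} [Fintype B] [DecidableEq B] (N : ℕ) (φ : B → ℂ)
    (U : unitaryGroup B ℂ) : Matrix (Fin N → B) (Fin N → B) ℂ :=
  ((N + Fintype.card B - 1).choose N : ℂ) • proj (tensorPow N (ketU φ U))

/-- The unnormalized state `tr_C ((𝕀_A ⊗ M) Ω)` of the first party after the second party
obtained the outcome with measurement operator `M`. -/
def postMeasure {A C : Type*} [Fintype A] [DecidableEq A] [Fintype C]
    (M : Matrix C C ℂ) (Ω : Matrix (A × C) (A × C) ℂ) : Matrix A A ℂ :=
  ptraceRight (((1 : Matrix A A ℂ) ⊗ₖ M) * Ω)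

end BoseExt

end

/-!
Measuring the `N` copies of `B` with the Haar-random measurement and preparing its outcome is an
expression in which the prepared vector plays the role of one further copy of `B`: the integrand is
a contraction of the extension `Ω` with `|U⟩⟨U|^{⊗(N+1)}`
(`postMeasure_kronecker_proj_apply`). Everything therefore rests on the moment identity
`∫ |U⟩⟨U|^{⊗M} dU = P_sym / dim Sym^M` for all `M` (`choose_mul_haarMoment`), used with `M = N` for
the completeness of the measurement and with `M = N + 1` for the decomposition.

The moment identity is proved without representation theory. Both sides are invariant under
permutations of the tensor factors, and invariance under diagonal unitaries shows that both vanish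
between product basis vectors with different multisets of letters (`haarMoment_eq_zero`). Since the
unitary group acts transitively on vectors of a given length, their quadratic forms on powers
`s^{⊗M}` of real vectors are both multiples of `‖s‖^{2M}`. Comparing coefficients of this polynomial
in the squares of the entries of `s` shows that the operators are proportional
(`eq_zero_of_quadraticForm_eq_zero`), and their traces give the constant.

In the contraction of `Ω` with `P_sym^{N+1} = (1/(N+1)!) ∑_π π`, a permutation that fixes the
prepared copy contributes `Λ_A ⊗ 𝕀`, and any other contributes `Λ`, because `Ω` absorbs permutations
of its copies of `B` (`sum_symProj_cons`). There are `N!` of the first kind and `N · N!` of the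
second, so the result is the noisy operator (`integral_postMeasure_kronecker_proj`).

The integrand is separable, and the separable operators form a closed convex cone, since they are
generated by a compact set of operators of trace one (`isClosed_setOf_isSeparable`); hence the
integral is separable (`isSeparable_noisy`). For a state the noisy operator is the output of the
depolarizing channel with `p = d / (N + d)`, and compactness of the set of separable states shows
that the critical probability is attained.
-/

/-! ### The symmetric projector in the product basis -/

namespace BoseExt

/-- The content of a word `x : Fin M → B`, that is the multiset of its letters. Two words have the
same content iff they differ by a permutation of the tensor factors. -/
def content {B : Type*} {M : ℕ} (x : Fin M → B) : Sym B M :=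
  ⟨Finset.univ.val.map x, by simp⟩

theorem content_comp {B : Type*} {M : ℕ} (x : Fin M → B) (σ : Equiv.Perm (Fin M)) :
    content (x ∘ σ) = content x := by
  refine Subtype.ext ?_
  change Finset.univ.val.map (x ∘ σ) = Finset.univ.val.map x
  rw [← Multiset.map_map, Multiset.map_univ_val_equiv]

theorem exists_perm_of_content_eq {B : Type*} {M : ℕ} {x y : Fin M → B}
    (h : content x = content y) : ∃ σ : Equiv.Perm (Fin M), y = x ∘ σ := by
  classical
  have h' : Finset.univ.val.map y = Finset.univ.val.map x := (congrArg Subtype.val h).symm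
  have hcard (b : B) : Fintype.card {k // y k = b} = Fintype.card {k // x k = b} := by
    have := congrArg (Multiset.count b) h'
    rw [Multiset.count_map, Multiset.count_map] at this
    rw [Fintype.card_subtype, Fintype.card_subtype]
    simpa [Finset.card, Finset.filter, eq_comm] using this
  refine ⟨Equiv.ofFiberEquiv fun b => Fintype.equivOfCardEq (hcard b), funext fun k => ?_⟩
  exact (Equiv.ofFiberEquiv_map _ k).symm

theorem content_surjective {B : Type*} {M : ℕ} :
    Function.Surjective (content : (Fin M → B) → Sym B M) := by
  rintro ⟨s, hs⟩
  induction s using Quotient.inductionOn with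
  | h l =>
    have hl : l.length = M := by simpa using hs
    subst hl
    exact ⟨l.get, Subtype.ext (by simp [content])⟩

theorem prod_map_content {B : Type*} {M : ℕ} (x : Fin M → B) (s : B → ℂ) :
    ((content x : Multiset B).map s).prod = ∏ k, s (x k) := by
  simp [content, Finset.prod, Function.comp_def]

theorem symProj_apply {B : Type*} [DecidableEq B] {M : ℕ} (x y : Fin M → B) :
    symProj B M x y =
      (M.factorial : ℂ)⁻¹ * ∑ π : Equiv.Perm (Fin M), if x ∘ π = y then 1 else 0 := by
  simp only [symProj, permOp, Matrix.smul_apply, Matrix.sum_apply, of_apply, smul_eq_mul]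
  congr 1
  refine Finset.sum_congr rfl fun π _ => if_congr ?_ rfl rfl
  constructor
  · rintro rfl
    funext k
    simp
  · rintro rfl
    funext k
    simp

theorem symProj_comp_right {B : Type*} [DecidableEq B] {M : ℕ} (x y : Fin M → B)
    (σ : Equiv.Perm (Fin M)) : symProj B M x (y ∘ σ) = symProj B M x y := by
  rw [symProj_apply, symProj_apply]
  congr 1
  refine Fintype.sum_equiv (Equiv.mulRight σ⁻¹) _ _ fun π => if_congr ?_ rfl rfl
  simp only [funext_iff, Function.comp_apply, Equiv.coe_mulRight, Equiv.Perm.mul_apply]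
  constructor
  · intro h k
    simpa using h (σ⁻¹ k)
  · intro h k
    simpa using h (σ k)

theorem symProj_comp_left {B : Type*} [DecidableEq B] {M : ℕ} (x y : Fin M → B)
    (σ : Equiv.Perm (Fin M)) : symProj B M (x ∘ σ) y = symProj B M x y := by
  rw [symProj_apply, symProj_apply]
  congr 1
  exact Fintype.sum_equiv (Equiv.mulLeft σ) _ _ fun π => if_congr Iff.rfl rfl rfl

theorem symProj_eq_zero {B : Type*} [DecidableEq B] {M : ℕ} {x y : Fin M → B}
    (h : content x ≠ content y) : symProj B M x y = 0 := by
  rw [symProj_apply, Finset.sum_eq_zero, mul_zero]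
  rintro π -
  refine if_neg ?_
  rintro rfl
  exact h (content_comp x π).symm

theorem sum_symProj_mul {B : Type*} [Fintype B] [DecidableEq B] {M : ℕ} (x : Fin M → B)
    (f : (Fin M → B) → ℂ) :
    ∑ y, symProj B M x y * f y =
      (M.factorial : ℂ)⁻¹ * ∑ π : Equiv.Perm (Fin M), f (x ∘ π) := by
  simp only [symProj_apply, mul_assoc, ← Finset.mul_sum, Finset.sum_mul]
  rw [Finset.sum_comm]
  simp

theorem card_filter_content_mul_symProj {B : Type*} [Fintype B] [DecidableEq B] {M : ℕ}
    (x : Fin M → B) :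
    ((Finset.univ.filter fun y : Fin M → B => content y = content x).card : ℂ) *
      symProj B M x x = 1 := by
  have h1 : ∑ y, symProj B M x y = 1 := by
    have := sum_symProj_mul x fun _ => 1
    simp only [mul_one, Finset.sum_const, Finset.card_univ, Fintype.card_perm, Fintype.card_fin,
      nsmul_eq_mul] at this
    rw [this, inv_mul_cancel₀ (Nat.cast_ne_zero.2 M.factorial_ne_zero)]
  rw [← h1, ← nsmul_eq_mul, ← Finset.sum_const, Finset.sum_filter]
  refine Finset.sum_congr rfl fun y _ => ?_
  split_ifs with h
  · obtain ⟨σ, rfl⟩ := exists_perm_of_content_eq h.symm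
    rw [symProj_comp_right]
  · rw [symProj_eq_zero (Ne.symm h)]

/-- The dimension of the symmetric subspace: each content contributes one to the trace. -/
theorem sum_symProj_diag {B : Type*} [Fintype B] [DecidableEq B] [Nonempty B] (M : ℕ) :
    ∑ x, symProj B M x x = ((M + Fintype.card B - 1).choose M : ℂ) := by
  rw [← Finset.sum_fiberwise Finset.univ (content : (Fin M → B) → Sym B M)]
  have h (s : Sym B M) : ∑ x with content x = s, symProj B M x x = 1 := by
    obtain ⟨x₀, rfl⟩ := content_surjective s
    rw [← card_filter_content_mul_symProj x₀, ← nsmul_eq_mul, ← Finset.sum_const]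
    refine Finset.sum_congr rfl fun x hx => ?_
    obtain ⟨σ, rfl⟩ := exists_perm_of_content_eq (Finset.mem_filter.1 hx).2.symm
    rw [symProj_comp_left, symProj_comp_right]
  simp only [h, Finset.sum_const, Finset.card_univ, nsmul_eq_mul, mul_one]
  rw [Sym.card_sym_eq_choose, add_comm]

/-- A matrix on `(ℂ^B)^{⊗M}` that is supported on the symmetric subspace and is block diagonal with
respect to the content is determined by its quadratic form on the powers `s^{⊗M}` of real vectors:
the coefficient of a monomial in the squares of the entries of `s` is the sum of the entries of one
block, and these entries all agree. -/
theorem eq_zero_of_quadraticForm_eq_zero {B : Type*} [Fintype B] [DecidableEq B] {M : ℕ}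
    (G : (Fin M → B) → (Fin M → B) → ℂ)
    (hl : ∀ (σ : Equiv.Perm (Fin M)) x y, G (x ∘ σ) y = G x y)
    (hr : ∀ (σ : Equiv.Perm (Fin M)) x y, G x (y ∘ σ) = G x y)
    (h0 : ∀ x y, content x ≠ content y → G x y = 0)
    (hs : ∀ s : B → ℝ, ∑ x, ∑ y, G x y * ((∏ k, (s (x k) : ℂ)) * ∏ k, (s (y k) : ℂ)) = 0)
    (x₀ y₀ : Fin M → B) : G x₀ y₀ = 0 := by
  classical
  let p : MvPolynomial B ℂ := ∑ x : Fin M → B, ∑ y : Fin M → B,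
    MvPolynomial.monomial (Multiset.toFinsupp (content x : Multiset B)) (G x y)
  have hp : p = 0 := by
    -- The variables stand for the squares of the entries of `s`; squares of natural numbers already
    -- form an infinite set.
    refine MvPolynomial.funext_set (fun _ => Set.range fun r : ℕ => ((r : ℂ)) ^ 2)
      (fun _ => Set.infinite_range_of_injective ?_) ?_
    · intro r r' h
      dsimp only at h
      have h' : r ^ 2 = r' ^ 2 := by exact_mod_cast h
      exact Nat.pow_left_injective two_ne_zero h'
    · intro t ht
      choose s hs' using fun b => ht b (Set.mem_univ b)
      have := hs fun b => (s b : ℝ)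
      rw [map_zero, ← this]
      simp only [p, map_sum]
      refine Finset.sum_congr rfl fun x _ => Finset.sum_congr rfl fun y _ => ?_
      by_cases hxy : content x = content y
      · obtain ⟨σ, rfl⟩ := exists_perm_of_content_eq hxy
        rw [MvPolynomial.eval_monomial, Finsupp.prod, Multiset.toFinsupp_support]
        have h2 : ∏ k, ((s ((x ∘ σ) k) : ℝ) : ℂ) = ∏ k, ((s (x k) : ℝ) : ℂ) :=
          Equiv.prod_comp σ fun k => ((s (x k) : ℝ) : ℂ)
        rw [h2, ← Finset.prod_mul_distrib]
        congr 1
        simp only [Multiset.toFinsupp_apply]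
        rw [← Finset.prod_multiset_map_count, prod_map_content]
        refine Finset.prod_congr rfl fun k _ => ?_
        rw [← hs' (x k)]
        push_cast
        ring
      · simp [h0 x y hxy]
  have hdiag : G x₀ x₀ = 0 := by
    have hc := congrArg (MvPolynomial.coeff (Multiset.toFinsupp (content x₀ : Multiset B))) hp
    simp only [p, MvPolynomial.coeff_sum, MvPolynomial.coeff_monomial, MvPolynomial.coeff_zero,
      EmbeddingLike.apply_eq_iff_eq, Sym.coe_inj] at hc
    have hsum (x : Fin M → B) : (∑ y, if content x = content x₀ then G x y else 0) =
        if content x = content x₀ then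
          ((Finset.univ.filter fun y : Fin M → B => content y = content x₀).card : ℂ) * G x₀ x₀
        else 0 := by
      split_ifs with h
      · rw [← nsmul_eq_mul, ← Finset.sum_const, Finset.sum_filter]
        refine Finset.sum_congr rfl fun y _ => ?_
        obtain ⟨σ, rfl⟩ := exists_perm_of_content_eq h.symm
        rw [hl]
        split_ifs with hy
        · obtain ⟨τ, rfl⟩ := exists_perm_of_content_eq hy.symm
          rw [hr]
        · exact h0 _ _ (Ne.symm hy)
      · simp
    simp only [hsum] at hc
    rw [← Finset.sum_filter, Finset.sum_const, nsmul_eq_mul] at hc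
    have hne : ((Finset.univ.filter fun y : Fin M → B => content y = content x₀).card : ℂ) ≠ 0 :=
      Nat.cast_ne_zero.2 (Finset.card_ne_zero.2 ⟨x₀, by simp⟩)
    simpa [hne] using hc
  by_cases h : content x₀ = content y₀
  · obtain ⟨σ, rfl⟩ := exists_perm_of_content_eq h
    rw [hr, hdiag]
  · exact h0 _ _ h

end BoseExt

/-! ### Moments of a Haar-random vector -/

namespace BoseExt

instance isProbabilityMeasure_haarUnitary (B : Type*) [Fintype B] [DecidableEq B] :
    IsProbabilityMeasure (haarUnitary B) :=
  ⟨by simpa [haarUnitary] using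
    Measure.haarMeasure_self (K₀ := (⊤ : TopologicalSpace.PositiveCompacts (unitaryGroup B ℂ)))⟩

instance isMulLeftInvariant_haarUnitary (B : Type*) [Fintype B] [DecidableEq B] :
    (haarUnitary B).IsMulLeftInvariant :=
  inferInstanceAs (Measure.haarMeasure _).IsMulLeftInvariant

theorem integrable_haarUnitary {B : Type*} [Fintype B] [DecidableEq B]
    {E : Type*} [NormedAddCommGroup E]
    {f : unitaryGroup B ℂ → E} (hf : Continuous f) : Integrable f (haarUnitary B) :=
  hf.integrable_of_hasCompactSupport (HasCompactSupport.of_compactSpace f)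

theorem continuous_ketU {B : Type*} [Fintype B] [DecidableEq B] (φ : B → ℂ) :
    Continuous fun U : unitaryGroup B ℂ => ketU φ U :=
  Continuous.matrix_mulVec continuous_subtype_val continuous_const

theorem ketU_mul {B : Type*} [Fintype B] [DecidableEq B] (φ : B → ℂ) (V U : unitaryGroup B ℂ) :
    ketU φ (V * U) = (V : Matrix B B ℂ) *ᵥ ketU φ U := by
  simp [ketU, Matrix.mulVec_mulVec]

theorem isUnitVec_ketU {B : Type*} [Fintype B] [DecidableEq B] {φ : B → ℂ} (hφ : IsUnitVec φ)
    (U : unitaryGroup B ℂ) : IsUnitVec (ketU φ U) := by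
  have h : (U : Matrix B B ℂ)ᴴ * (U : Matrix B B ℂ) = 1 := mem_unitaryGroup_iff'.1 U.2
  rw [IsUnitVec, ketU, star_mulVec, dotProduct_mulVec, vecMul_vecMul, h, vecMul_one]
  exact hφ

theorem continuous_proj_tensorPow_ketU {B : Type*} [Fintype B] [DecidableEq B] (M : ℕ) (φ : B → ℂ)
    (x y : Fin M → B) :
    Continuous fun U : unitaryGroup B ℂ => proj (tensorPow M (ketU φ U)) x y := by
  have h (b : B) : Continuous fun U : unitaryGroup B ℂ => ketU φ U b :=
    (continuous_apply b).comp (continuous_ketU φ)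
  simp only [proj, vecMulVec_apply, tensorPow, Pi.star_apply]
  exact (continuous_finsetProd _ fun k _ => h _).mul
    (continuous_finsetProd _ fun k _ => h _).star

/-- The average of `|U⟩⟨U|^{⊗M}` over the Haar measure, entry by entry. -/
noncomputable def haarMoment {B : Type*} [Fintype B] [DecidableEq B] (M : ℕ) (φ : B → ℂ)
    (x y : Fin M → B) : ℂ :=
  ∫ U, proj (tensorPow M (ketU φ U)) x y ∂(haarUnitary B)

theorem haarMoment_comp_left {B : Type*} [Fintype B] [DecidableEq B] {M : ℕ} (φ : B → ℂ)
    (σ : Equiv.Perm (Fin M)) (x y : Fin M → B) :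
    haarMoment M φ (x ∘ σ) y = haarMoment M φ x y := by
  refine integral_congr_ae (Filter.Eventually.of_forall fun U => ?_)
  simp only [proj, vecMulVec_apply, tensorPow, Pi.star_apply]
  congr 1
  exact Equiv.prod_comp σ fun k => ketU φ U (x k)

theorem haarMoment_comp_right {B : Type*} [Fintype B] [DecidableEq B] {M : ℕ} (φ : B → ℂ)
    (σ : Equiv.Perm (Fin M)) (x y : Fin M → B) :
    haarMoment M φ x (y ∘ σ) = haarMoment M φ x y := by
  refine integral_congr_ae (Filter.Eventually.of_forall fun U => ?_)
  simp only [proj, vecMulVec_apply, tensorPow, Pi.star_apply]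
  congr 2
  exact Equiv.prod_comp σ fun k => ketU φ U (y k)

/-- Invariance under diagonal unitaries kills the moments between words of different content:
multiplying the coordinate `b` by a primitive root of unity of order `M + 1` detects the number of
letters `b`. -/
theorem haarMoment_eq_zero {B : Type*} [Fintype B] [DecidableEq B] {M : ℕ} (φ : B → ℂ)
    {x y : Fin M → B} (hxy : content x ≠ content y) : haarMoment M φ x y = 0 := by
  by_contra hne
  refine hxy (Subtype.ext (Multiset.ext.2 fun b => ?_))
  change Multiset.count b (Finset.univ.val.map x) = Multiset.count b (Finset.univ.val.map y)
  have hcount (z : Fin M → B) : Multiset.count b (Finset.univ.val.map z) =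
      (Finset.univ.filter fun k => z k = b).card := by
    rw [Multiset.count_map]
    simp [Finset.card, Finset.filter, eq_comm]
  rw [hcount, hcount]
  have hθ := Complex.isPrimitiveRoot_exp (M + 1) M.succ_ne_zero
  set θ : ℂ := Complex.exp (2 * Real.pi * Complex.I / ((M + 1 : ℕ) : ℂ))
  have hnorm : θ * star θ = 1 := by
    have h1 : ‖θ‖ = 1 := hθ.norm'_eq_one M.succ_ne_zero
    rw [Complex.star_def, Complex.mul_conj, Complex.normSq_eq_norm_sq, h1]
    simp
  have hD : diagonal (Function.update (1 : B → ℂ) b θ) ∈ unitaryGroup B ℂ := by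
    rw [mem_unitaryGroup_iff, star_eq_conjTranspose, diagonal_conjTranspose, diagonal_mul_diagonal,
      ← diagonal_one]
    congr 1
    funext c
    by_cases hc : c = b
    · subst hc
      simpa using hnorm
    · simp [hc]
  have hprod (z : Fin M → B) : ∏ k, Function.update (1 : B → ℂ) b θ (z k) =
      θ ^ (Finset.univ.filter fun k => z k = b).card := by
    simp only [Function.update_apply, Pi.one_apply]
    rw [Finset.prod_ite]
    simp
  have hinv : haarMoment M φ x y =
      θ ^ (Finset.univ.filter fun k => x k = b).card *
        star (θ ^ (Finset.univ.filter fun k => y k = b).card) * haarMoment M φ x y := by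
    conv_lhs => rw [haarMoment,
      ← integral_mul_left_eq_self _ (⟨_, hD⟩ : unitaryGroup B ℂ)]
    rw [haarMoment, ← integral_const_mul]
    refine integral_congr_ae (Filter.Eventually.of_forall fun U => ?_)
    simp only [ketU_mul, proj, vecMulVec_apply, tensorPow, Pi.star_apply, mulVec_diagonal,
      Finset.prod_mul_distrib, hprod, star_mul']
    ring
  have h1 := mul_right_cancel₀ hne ((one_mul _).trans hinv)
  refine hθ.pow_inj (Nat.lt_succ_of_le ?_) (Nat.lt_succ_of_le ?_) ?_
  · exact (Finset.card_le_univ _).trans (Fintype.card_fin M).le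
  · exact (Finset.card_le_univ _).trans (Fintype.card_fin M).le
  · have h2 : ∀ q : ℕ, star (θ ^ q) * θ ^ q = 1 := fun q => by
      rw [star_pow, ← mul_pow, mul_comm, hnorm, one_pow]
    calc _ = θ ^ (Finset.univ.filter fun k => x k = b).card *
          (star (θ ^ (Finset.univ.filter fun k => y k = b).card) *
            θ ^ (Finset.univ.filter fun k => y k = b).card) := by rw [h2, mul_one]
      _ = _ := by rw [← mul_assoc, ← h1, one_mul]

theorem exists_unitary_row {B : Type*} [Fintype B] [DecidableEq B] (b₀ : B) {v : B → ℂ}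
    (hv : IsUnitVec v) : ∃ W : unitaryGroup B ℂ, ∀ b, (W : Matrix B B ℂ) b₀ b = v b := by
  have hnorm : ‖(WithLp.toLp 2 (star v) : EuclideanSpace ℂ B)‖ = 1 := by
    rw [← sq_eq_sq₀ (norm_nonneg _) zero_le_one, one_pow, EuclideanSpace.norm_sq_eq]
    have : ((∑ i, ‖v i‖ ^ 2 : ℝ) : ℂ) = 1 := by
      rw [← hv, dotProduct]
      push_cast
      refine Finset.sum_congr rfl fun i _ => ?_
      rw [Pi.star_apply, Complex.star_def, Complex.conj_mul']
    simpa using Complex.ofReal_injective (this.trans Complex.ofReal_one.symm)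
  have horth : Orthonormal ℂ (({b₀} : Set B).domRestrict
      fun _ : B => (WithLp.toLp 2 (star v) : EuclideanSpace ℂ B)) := by
    refine ⟨fun _ => hnorm, fun i j hij => (hij (Subsingleton.elim i j)).elim⟩
  obtain ⟨e, he⟩ := horth.exists_orthonormalBasis_extension_of_card_eq (by simp)
  have hU := (EuclideanSpace.basisFun B ℂ).toMatrix_orthonormalBasis_mem_unitary e
  refine ⟨star ⟨_, hU⟩, fun b => ?_⟩
  have := he b₀ rfl
  simp [Module.Basis.toMatrix_apply, this]

/-- A real linear functional of length `r` is `r` times a coordinate functional, up to a unitary. -/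
theorem exists_unitary_dotProduct {B : Type*} [Fintype B] [DecidableEq B] (b₀ : B) (s : B → ℝ) :
    ∃ (W : unitaryGroup B ℂ) (r : ℝ), r ^ 2 = ∑ b, s b ^ 2 ∧
      ∀ ψ : B → ℂ, ∑ b, (s b : ℂ) * ψ b = r * ((W : Matrix B B ℂ) *ᵥ ψ) b₀ := by
  have hr : Real.sqrt (∑ b, s b ^ 2) ^ 2 = ∑ b, s b ^ 2 :=
    Real.sq_sqrt (Finset.sum_nonneg fun b _ => sq_nonneg _)
  set r : ℝ := Real.sqrt (∑ b, s b ^ 2)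
  by_cases h0 : r = 0
  · refine ⟨1, r, hr, fun ψ => ?_⟩
    have hs : ∀ b, s b = 0 := fun b => by
      rw [h0, zero_pow two_ne_zero] at hr
      exact pow_eq_zero_iff two_ne_zero |>.1
        ((Finset.sum_eq_zero_iff_of_nonneg fun b _ => sq_nonneg (s b)).1 hr.symm b
          (Finset.mem_univ b))
    simp [hs, h0]
  · have hv : IsUnitVec fun b => ((s b / r : ℝ) : ℂ) := by
      simp only [IsUnitVec, dotProduct, Pi.star_apply, Complex.star_def, Complex.conj_ofReal]
      have : ∑ b, s b / r * (s b / r) = 1 := by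
        have h : ∀ b, s b / r * (s b / r) = s b ^ 2 / r ^ 2 := fun b => by ring
        simp only [h, ← Finset.sum_div]
        rw [← hr, div_self (pow_ne_zero 2 h0)]
      exact_mod_cast this
    obtain ⟨W, hW⟩ := exists_unitary_row b₀ hv
    refine ⟨W, r, hr, fun ψ => ?_⟩
    rw [mulVec, dotProduct, Finset.mul_sum]
    refine Finset.sum_congr rfl fun b _ => ?_
    rw [hW]
    push_cast
    field_simp [Complex.ofReal_ne_zero.2 h0]

theorem sum_sum_proj_tensorPow {B : Type*} [Fintype B] {M : ℕ} (ψ : B → ℂ) (s : B → ℝ) :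
    ∑ x : Fin M → B, ∑ y : Fin M → B,
      proj (tensorPow M ψ) x y * ((∏ k, (s (x k) : ℂ)) * ∏ k, (s (y k) : ℂ)) =
      ((∑ b, (s b : ℂ) * ψ b) * star (∑ b, (s b : ℂ) * ψ b)) ^ M := by
  rw [mul_pow, ← star_pow, Fintype.sum_pow, star_sum, Finset.sum_mul_sum]
  refine Finset.sum_congr rfl fun x _ => Finset.sum_congr rfl fun y _ => ?_
  simp only [proj, vecMulVec_apply, tensorPow, Pi.star_apply, Finset.prod_mul_distrib, star_mul',
    star_prod, Complex.star_def, Complex.conj_ofReal]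
  ring

/-- The quadratic form of the averaged operator on powers `s^{⊗M}` depends on the length of `s`
only, because the unitary group acts transitively on the vectors of a given length. -/
theorem haarMoment_quadraticForm {B : Type*} [Fintype B] [DecidableEq B] (M : ℕ) (φ : B → ℂ)
    (b₀ : B) (s : B → ℝ) :
    ∑ x : Fin M → B, ∑ y : Fin M → B,
      haarMoment M φ x y * ((∏ k, (s (x k) : ℂ)) * ∏ k, (s (y k) : ℂ)) =
      (∫ U, (ketU φ U b₀ * star (ketU φ U b₀)) ^ M ∂(haarUnitary B)) *
        (∑ b, (s b : ℂ) ^ 2) ^ M := by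
  obtain ⟨W, r, hr, hW⟩ := exists_unitary_dotProduct b₀ s
  have hint (x y : Fin M → B) : Integrable (fun U => proj (tensorPow M (ketU φ U)) x y *
      ((∏ k, (s (x k) : ℂ)) * ∏ k, (s (y k) : ℂ))) (haarUnitary B) :=
    (integrable_haarUnitary (continuous_proj_tensorPow_ketU M φ x y)).mul_const _
  simp only [haarMoment, ← integral_mul_const]
  have hr' : (∑ b, (s b : ℂ) ^ 2) = (r : ℂ) ^ 2 := by exact_mod_cast hr.symm
  calc _ = ∫ U, ∑ x : Fin M → B, ∑ y : Fin M → B, proj (tensorPow M (ketU φ U)) x y *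
        ((∏ k, (s (x k) : ℂ)) * ∏ k, (s (y k) : ℂ)) ∂(haarUnitary B) := by
        rw [integral_finsetSum _ fun x _ => integrable_finsetSum _ fun y _ => hint x y]
        exact Finset.sum_congr rfl fun x _ => (integral_finsetSum _ fun y _ => hint x y).symm
    _ = ∫ U, (ketU φ (W * U) b₀ * star (ketU φ (W * U) b₀)) ^ M * ((r : ℂ) ^ 2) ^ M
        ∂(haarUnitary B) := by
        refine integral_congr_ae (Filter.Eventually.of_forall fun U => ?_)
        simp only [sum_sum_proj_tensorPow, hW, ketU_mul, star_mul', Complex.star_def,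
          Complex.conj_ofReal]
        ring
    _ = _ := by
        rw [hr', integral_mul_left_eq_self
          (fun U => (ketU φ U b₀ * star (ketU φ U b₀)) ^ M * ((r : ℂ) ^ 2) ^ M) W]

theorem symProj_quadraticForm {B : Type*} [Fintype B] [DecidableEq B] (M : ℕ) (s : B → ℝ) :
    ∑ x : Fin M → B, ∑ y : Fin M → B,
      symProj B M x y * ((∏ k, (s (x k) : ℂ)) * ∏ k, (s (y k) : ℂ)) =
      (∑ b, (s b : ℂ) ^ 2) ^ M := by
  rw [Fintype.sum_pow]
  refine Finset.sum_congr rfl fun x _ => ?_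
  rw [sum_symProj_mul x fun y => (∏ k, (s (x k) : ℂ)) * ∏ k, (s (y k) : ℂ)]
  have h (π : Equiv.Perm (Fin M)) : ∏ k, (s ((x ∘ π) k) : ℂ) = ∏ k, (s (x k) : ℂ) :=
    Equiv.prod_comp π fun k => (s (x k) : ℂ)
  simp only [h, Finset.sum_const, Finset.card_univ, Fintype.card_perm, Fintype.card_fin,
    nsmul_eq_mul]
  rw [inv_mul_cancel_left₀ (Nat.cast_ne_zero.2 M.factorial_ne_zero), ← Finset.prod_mul_distrib]
  exact Finset.prod_congr rfl fun k _ => (sq _).symm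

theorem sum_haarMoment_diag {B : Type*} [Fintype B] [DecidableEq B] (M : ℕ) {φ : B → ℂ}
    (hφ : IsUnitVec φ) : ∑ x : Fin M → B, haarMoment M φ x x = 1 := by
  simp only [haarMoment]
  rw [← integral_finsetSum _ fun x _ =>
    integrable_haarUnitary (continuous_proj_tensorPow_ketU M φ x x)]
  have h (U : unitaryGroup B ℂ) : ∑ x : Fin M → B, proj (tensorPow M (ketU φ U)) x x = 1 := by
    have hU := isUnitVec_ketU hφ U
    calc _ = (∑ b, star (ketU φ U) b * ketU φ U b) ^ M := by
          rw [Fintype.sum_pow]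
          refine Finset.sum_congr rfl fun x _ => ?_
          simp only [proj, vecMulVec_apply, tensorPow, Pi.star_apply, Finset.prod_mul_distrib,
            star_prod]
          ring
      _ = 1 := by
          rw [IsUnitVec, dotProduct] at hU
          rw [hU, one_pow]
  simp [h]

/-- The averaged operator `∫ |U⟩⟨U|^{⊗M} dU` is the projector onto the symmetric subspace, divided
by the dimension of that subspace. -/
theorem choose_mul_haarMoment {B : Type*} [Fintype B] [DecidableEq B] [Nonempty B] (M : ℕ)
    {φ : B → ℂ} (hφ : IsUnitVec φ) (x y : Fin M → B) :
    ((M + Fintype.card B - 1).choose M : ℂ) * haarMoment M φ x y = symProj B M x y := by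
  have b₀ : B := Classical.arbitrary B
  set c : ℂ := ∫ U, (ketU φ U b₀ * star (ketU φ U b₀)) ^ M ∂(haarUnitary B)
  have key (x y : Fin M → B) : haarMoment M φ x y = c * symProj B M x y := by
    rw [← sub_eq_zero]
    refine eq_zero_of_quadraticForm_eq_zero
      (fun x y => haarMoment M φ x y - c * symProj B M x y) ?_ ?_ ?_ ?_ x y
    · intro σ x y
      rw [haarMoment_comp_left, symProj_comp_left]
    · intro σ x y
      rw [haarMoment_comp_right, symProj_comp_right]
    · intro x y h
      rw [haarMoment_eq_zero φ h, symProj_eq_zero h, mul_zero, sub_zero]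
    · intro s
      simp only [sub_mul, Finset.sum_sub_distrib, mul_assoc, ← Finset.mul_sum]
      rw [haarMoment_quadraticForm M φ b₀, symProj_quadraticForm, sub_self]
  -- Comparing traces determines the constant.
  have htr := sum_haarMoment_diag M hφ
  simp only [key, ← Finset.mul_sum] at htr
  rw [sum_symProj_diag] at htr
  rw [key, ← mul_assoc, mul_comm _ c, htr, one_mul]

end BoseExt

/-! ### The measure-and-prepare decomposition -/

namespace BoseExt

/-- Splitting a permutation of `N + 1` letters by the image of `0`: the identity on the prepared
system contributes the trace of `H`, and each of the `N` other images contributes the same reduced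
sum, by the symmetry of `H`. -/
theorem sum_symProj_cons {B : Type*} [Fintype B] [DecidableEq B] {N : ℕ} [NeZero N]
    (H : (Fin N → B) → (Fin N → B) → ℂ)
    (hl : ∀ (σ : Equiv.Perm (Fin N)) x y, H (x ∘ σ) y = H x y)
    (hr : ∀ (σ : Equiv.Perm (Fin N)) x y, H x (y ∘ σ) = H x y) (b b' : B) :
    ((N : ℂ) + 1) * ∑ x : Fin N → B, ∑ y : Fin N → B,
        symProj B (N + 1) (Fin.cons b x : Fin (N + 1) → B) (Fin.cons b' y : Fin (N + 1) → B) *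
          H y x =
      (if b = b' then ∑ x, H x x else 0) +
        N * ∑ x : Fin N → B, if x 0 = b then H x (Function.update x 0 b') else 0 := by
  -- The sum over `y` has at most one term, and does not depend on the permutation `e` of the
  -- remaining letters.
  have hterm (p : Fin (N + 1)) (e : Equiv.Perm (Fin N)) (x : Fin N → B) :
      (∑ y : Fin N → B, (if (Fin.cons b x : Fin (N + 1) → B) ∘ Equiv.Perm.decomposeFin.symm (p, e) =
        (Fin.cons b' y : Fin (N + 1) → B) then 1 else 0) * H y x) =
      if (Fin.cons b x : Fin (N + 1) → B) p = b' then
        H (fun i => (Fin.cons b x : Fin (N + 1) → B) (Equiv.swap 0 p i.succ)) x else 0 := by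
    have hiff (y : Fin N → B) :
        (Fin.cons b x : Fin (N + 1) → B) ∘ Equiv.Perm.decomposeFin.symm (p, e) =
          (Fin.cons b' y : Fin (N + 1) → B) ↔ (Fin.cons b x : Fin (N + 1) → B) p = b' ∧
            (fun i => (Fin.cons b x : Fin (N + 1) → B) (Equiv.swap 0 p i.succ)) ∘ e = y := by
      rw [funext_iff, Fin.forall_fin_succ, funext_iff]
      simp
    simp only [hiff, ite_and, ite_mul, one_mul, zero_mul]
    split_ifs
    · rw [Finset.sum_ite_eq Finset.univ, if_pos (Finset.mem_univ _), hl]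
    · simp
  -- The symmetry of `H` moves the distinguished copy `q` to the first one.
  have hq (q : Fin N) : (∑ x : Fin N → B, if (Fin.cons b x : Fin (N + 1) → B) q.succ = b' then
        H (fun i => (Fin.cons b x : Fin (N + 1) → B) (Equiv.swap 0 q.succ i.succ)) x else 0) =
      ∑ x : Fin N → B, if x 0 = b then H x (Function.update x 0 b') else 0 := by
    have hupd (x : Fin N → B) :
        (fun i => (Fin.cons b x : Fin (N + 1) → B) (Equiv.swap 0 q.succ i.succ)) =
          Function.update x q b := by
      funext i
      by_cases hi : i = q
      · subst hi
        simp
      · rw [Equiv.swap_apply_of_ne_of_ne (Fin.succ_ne_zero i) (by simpa using hi)]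
        simp [hi]
    simp only [hupd, Fin.cons_succ]
    calc _ = ∑ x : Fin N → B, if x 0 = b' then H (Function.update x 0 b) x else 0 := by
          refine Fintype.sum_equiv (Equiv.arrowCongr (Equiv.swap 0 q) (Equiv.refl B)) _ _
            fun x => ?_
          have hx : (Equiv.arrowCongr (Equiv.swap 0 q) (Equiv.refl B)) x = x ∘ Equiv.swap 0 q := by
            ext i
            simp [Equiv.arrowCongr]
          rw [hx, hr]
          have h2 : Function.update (x ∘ Equiv.swap 0 q) 0 b =
              Function.update x q b ∘ Equiv.swap 0 q := by
            rw [Function.update_comp_equiv]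
            simp
          rw [h2, hl]
          simp
      _ = _ := by
          rw [← Finset.sum_filter, ← Finset.sum_filter]
          refine Finset.sum_nbij' (fun x => Function.update x 0 b) (fun x => Function.update x 0 b')
            (by simp) (by simp) ?_ ?_ ?_
          · intro x hx
            simp only [Function.update_idem, ← (Finset.mem_filter.1 hx).2, Function.update_eq_self]
          · intro x hx
            simp only [Function.update_idem, ← (Finset.mem_filter.1 hx).2, Function.update_eq_self]
          · intro x hx
            simp only [Function.update_idem, ← (Finset.mem_filter.1 hx).2, Function.update_eq_self]
  have hexp : ∑ x : Fin N → B, ∑ y : Fin N → B,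
        symProj B (N + 1) (Fin.cons b x : Fin (N + 1) → B) (Fin.cons b' y : Fin (N + 1) → B) *
          H y x =
      ((N + 1).factorial : ℂ)⁻¹ * ∑ pe : Fin (N + 1) × Equiv.Perm (Fin N), ∑ x : Fin N → B,
        if (Fin.cons b x : Fin (N + 1) → B) pe.1 = b' then
          H (fun i => (Fin.cons b x : Fin (N + 1) → B) (Equiv.swap 0 pe.1 i.succ)) x else 0 := by
    simp only [symProj_apply, mul_assoc, ← Finset.mul_sum, Finset.sum_mul]
    congr 1
    conv_rhs => rw [Finset.sum_comm]
    refine Finset.sum_congr rfl fun x _ => ?_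
    rw [Finset.sum_comm, ← Equiv.sum_comp Equiv.Perm.decomposeFin.symm]
    exact Finset.sum_congr rfl fun pe _ => hterm pe.1 pe.2 x
  rw [hexp, Fintype.sum_prod_type]
  simp only [Finset.sum_const, Finset.card_univ, Fintype.card_perm, Fintype.card_fin,
    nsmul_eq_mul, ← Finset.mul_sum]
  rw [Fin.sum_univ_succ]
  simp only [hq]
  simp only [Finset.sum_const, Finset.card_univ, Fintype.card_fin, nsmul_eq_mul, Fin.cons_zero,
    Equiv.swap_self, Equiv.refl_apply, Fin.cons_succ]
  have hN : (N.factorial : ℂ) ≠ 0 := Nat.cast_ne_zero.2 N.factorial_ne_zero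
  have hN1 : (N : ℂ) + 1 ≠ 0 := by exact_mod_cast N.succ_ne_zero
  rw [Nat.factorial_succ]
  push_cast
  field_simp
  split_ifs <;> simp

theorem IsBSE.comp_right {A B : Type*} [Fintype A] [DecidableEq A] [Fintype B] [DecidableEq B]
    {N : ℕ} [NeZero N] {Λ : Matrix (A × B) (A × B) ℂ}
    {Ω : Matrix (A × (Fin N → B)) (A × (Fin N → B)) ℂ} (h : IsBSE N Λ Ω)
    (i : A × (Fin N → B)) (a : A) (σ : Equiv.Perm (Fin N)) (y : Fin N → B) :
    Ω i (a, y ∘ σ) = Ω i (a, y) := by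
  have hΩ (z : Fin N → B) : Ω i (a, z) =
      ∑ k, Ω i k * ((1 : Matrix A A ℂ) k.1 a * symProj B N k.2 z) := by
    conv_lhs => rw [← h.symmetric, Matrix.mul_apply]
    rfl
  rw [hΩ, hΩ y]
  simp only [symProj_comp_right]

theorem IsBSE.comp_left {A B : Type*} [Fintype A] [DecidableEq A] [Fintype B] [DecidableEq B]
    {N : ℕ} [NeZero N] {Λ : Matrix (A × B) (A × B) ℂ}
    {Ω : Matrix (A × (Fin N → B)) (A × (Fin N → B)) ℂ} (h : IsBSE N Λ Ω)
    (j : A × (Fin N → B)) (a : A) (σ : Equiv.Perm (Fin N)) (x : Fin N → B) :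
    Ω (a, x ∘ σ) j = Ω (a, x) j := by
  rw [← h.posSemidef.1.apply, h.comp_right, h.posSemidef.1.apply]

theorem IsBSE.ptraceRight_apply {A B : Type*} [Fintype A] [DecidableEq A] [Fintype B]
    [DecidableEq B] {N : ℕ} [NeZero N] {Λ : Matrix (A × B) (A × B) ℂ}
    {Ω : Matrix (A × (Fin N → B)) (A × (Fin N → B)) ℂ} (h : IsBSE N Λ Ω) (a a' : A) :
    ptraceRight Λ a a' = ∑ x : Fin N → B, Ω (a, x) (a', x) := by
  rw [← h.reduce]
  simp only [ptraceRight, reduceFirst, of_apply]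
  rw [Finset.sum_comm]
  simp

theorem postMeasure_smul_proj_apply {A C : Type*} [Fintype A] [DecidableEq A] [Fintype C]
    (c : ℂ) (w : C → ℂ) (Ω : Matrix (A × C) (A × C) ℂ) (a a' : A) :
    postMeasure (c • proj w) Ω a a' =
      c * ∑ x, ∑ y, w x * star (w y) * Ω (a, y) (a', x) := by
  simp only [postMeasure, ptraceRight, of_apply, Matrix.mul_apply, kroneckerMap_apply,
    Fintype.sum_prod_type, Matrix.smul_apply, smul_eq_mul, proj, vecMulVec_apply, Pi.star_apply,
    Matrix.one_apply, ite_mul, zero_mul, one_mul]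
  rw [Finset.mul_sum]
  refine Finset.sum_congr rfl fun x _ => ?_
  rw [Finset.sum_comm, Finset.mul_sum]
  refine Finset.sum_congr rfl fun y _ => ?_
  simp [mul_assoc]

theorem postMeasure_posSemidef {A C : Type*} [Fintype A] [DecidableEq A] [Fintype C]
    [DecidableEq C] {c : ℂ} (hc : 0 ≤ c) (w : C → ℂ) {Ω : Matrix (A × C) (A × C) ℂ}
    (hΩ : Ω.PosSemidef) : (postMeasure (c • proj w) Ω).PosSemidef := by
  let V : Matrix (A × C) A ℂ := of fun i a => if i.1 = a then w i.2 else 0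
  have h : postMeasure (c • proj w) Ω = c • (Vᴴ * Ω * V) := by
    ext a a'
    rw [postMeasure_smul_proj_apply]
    simp only [V, Matrix.smul_apply, smul_eq_mul, Matrix.mul_apply, conjTranspose_apply, of_apply,
      Fintype.sum_prod_type_right, mul_ite, mul_zero, apply_ite star, star_zero, ite_mul, zero_mul,
      Finset.sum_ite_eq', Finset.mem_univ, if_true, Finset.sum_mul]
    congr 1
    exact Finset.sum_congr rfl fun x _ => Finset.sum_congr rfl fun y _ => by ring
  rw [h]
  exact (hΩ.conjTranspose_mul_mul_same V).smul hc

theorem proj_posSemidef {m : Type*} [Fintype m] (v : m → ℂ) : (proj v).PosSemidef :=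
  posSemidef_vecMulVec_self_star v

theorem haarPOVM_posSemidef {B : Type*} [Fintype B] [DecidableEq B] (N : ℕ) (φ : B → ℂ)
    (U : unitaryGroup B ℂ) : (haarPOVM N φ U).PosSemidef :=
  (proj_posSemidef _).smul (Nat.cast_nonneg _)

/-- The prepared vector acts as one further copy of the measured system, so that the decomposition
is governed by the moment of order `N + 1`. -/
theorem postMeasure_kronecker_proj_apply {A B : Type*} [Fintype A] [DecidableEq A] [Fintype B]
    [DecidableEq B] (N : ℕ) (φ : B → ℂ) (U : unitaryGroup B ℂ)
    (Ω : Matrix (A × (Fin N → B)) (A × (Fin N → B)) ℂ) (i j : A × B) :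
    (postMeasure (haarPOVM N φ U) Ω ⊗ₖ proj (ketU φ U)) i j =
      ((N + Fintype.card B - 1).choose N : ℂ) * ∑ x : Fin N → B, ∑ y : Fin N → B,
        proj (tensorPow (N + 1) (ketU φ U)) (Fin.cons i.2 x : Fin (N + 1) → B)
          (Fin.cons j.2 y : Fin (N + 1) → B) * Ω (i.1, y) (j.1, x) := by
  rw [kroneckerMap_apply, haarPOVM, postMeasure_smul_proj_apply, mul_assoc]
  simp only [Finset.sum_mul]
  congr 1
  refine Finset.sum_congr rfl fun x _ => Finset.sum_congr rfl fun y _ => ?_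
  simp only [proj, vecMulVec_apply, tensorPow, Pi.star_apply, Fin.prod_univ_succ, Fin.cons_zero,
    Fin.cons_succ, star_mul']
  ring

theorem continuous_postMeasure_kronecker_proj {A B : Type*} [Fintype A] [DecidableEq A] [Fintype B]
    [DecidableEq B] (N : ℕ) (φ : B → ℂ) (Ω : Matrix (A × (Fin N → B)) (A × (Fin N → B)) ℂ) :
    Continuous fun U => postMeasure (haarPOVM N φ U) Ω ⊗ₖ proj (ketU φ U) := by
  refine continuous_matrix fun i j => ?_
  simp only [postMeasure_kronecker_proj_apply]
  exact continuous_const.mul (continuous_finsetSum _ fun x _ => continuous_finsetSum _ fun y _ =>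
    (continuous_proj_tensorPow_ketU _ φ _ _).mul continuous_const)

theorem integral_postMeasure_kronecker_proj {A B : Type*} [Fintype A] [DecidableEq A] [Fintype B]
    [DecidableEq B] [Nonempty B] {N : ℕ} [NeZero N] {φ : B → ℂ} (hφ : IsUnitVec φ)
    {Λ : Matrix (A × B) (A × B) ℂ} {Ω : Matrix (A × (Fin N → B)) (A × (Fin N → B)) ℂ}
    (h : IsBSE N Λ Ω) (i j : A × B) :
    ∫ U, (postMeasure (haarPOVM N φ U) Ω ⊗ₖ proj (ketU φ U)) i j ∂(haarUnitary B) =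
      noisy N Λ i j := by
  obtain ⟨a, b⟩ := i
  obtain ⟨a', b'⟩ := j
  have hint (x y : Fin N → B) : Integrable (fun U =>
      proj (tensorPow (N + 1) (ketU φ U)) (Fin.cons b x : Fin (N + 1) → B)
        (Fin.cons b' y : Fin (N + 1) → B) * Ω (a, y) (a', x)) (haarUnitary B) :=
    (integrable_haarUnitary (continuous_proj_tensorPow_ketU _ φ _ _)).mul_const _
  simp only [postMeasure_kronecker_proj_apply]
  rw [integral_const_mul,
    integral_finsetSum _ fun x _ => integrable_finsetSum _ fun y _ => hint x y]
  simp only [integral_finsetSum _ fun y _ => hint _ y, integral_mul_const]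
  have hsum := sum_symProj_cons (fun x y => Ω (a, x) (a', y))
    (fun σ x y => h.comp_left _ a σ x) (fun σ x y => h.comp_right _ a' σ y) b b'
  simp only [← choose_mul_haarMoment (N + 1) hφ, mul_assoc, ← Finset.mul_sum] at hsum
  have hred : (∑ x : Fin N → B, if x 0 = b then Ω (a, x) (a', Function.update x 0 b') else 0) =
      Λ (a, b) (a', b') := by
    rw [← h.reduce]
    rfl
  rw [hred, ← h.ptraceRight_apply] at hsum
  -- The ratio of the dimensions of the symmetric subspaces of orders `N` and `N + 1`.
  have hchoose : ((N : ℂ) + Fintype.card B) * ((N + Fintype.card B - 1).choose N : ℂ) =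
      ((N : ℂ) + 1) * ((N + 1 + Fintype.card B - 1).choose (N + 1) : ℂ) := by
    obtain ⟨d, hd⟩ := Nat.exists_eq_succ_of_ne_zero (Fintype.card_ne_zero (α := B))
    have h1 : N + Fintype.card B - 1 = N + d := by omega
    have h2 : N + 1 + Fintype.card B - 1 = N + d + 1 := by omega
    rw [h1, h2, hd]
    have := Nat.add_one_mul_choose_eq (N + d) N
    rw [mul_comm ((N : ℂ) + 1)]
    exact_mod_cast this
  rw [← mul_assoc, ← hchoose, mul_assoc] at hsum
  have hd0 : (N : ℂ) + Fintype.card B ≠ 0 := by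
    have : N + Fintype.card B ≠ 0 := by
      have := NeZero.ne N
      omega
    exact_mod_cast this
  refine mul_left_cancel₀ hd0 (hsum.trans ?_)
  simp only [noisy, Matrix.add_apply, Matrix.smul_apply, kroneckerMap_apply, Complex.real_smul,
    Matrix.one_apply]
  push_cast
  field_simp
  split_ifs <;> ring

end BoseExt

/-! ### The cone of separable operators -/

namespace BoseExt

/-- By Carathéodory's theorem the convex hull is the continuous image of the product of a standard
simplex with a power of `K`. -/
theorem isCompact_convexHull_of_isCompact {E : Type*} [AddCommGroup E] [Module ℝ E]
    [TopologicalSpace E] [ContinuousAdd E] [ContinuousSMul ℝ E] [FiniteDimensional ℝ E]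
    {K : Set E} (hK : IsCompact K) : IsCompact (convexHull ℝ K) := by
  obtain rfl | ⟨k₀, hk₀⟩ := K.eq_empty_or_nonempty
  · simp
  set n := Module.finrank ℝ E + 1
  have hc : IsCompact ((stdSimplex ℝ (Fin n)) ×ˢ Set.pi Set.univ fun _ : Fin n => K) :=
    (isCompact_stdSimplex ℝ (Fin n)).prod (isCompact_univ_pi fun _ => hK)
  have hf : Continuous fun q : (Fin n → ℝ) × (Fin n → E) => ∑ i, q.1 i • q.2 i := by fun_prop
  convert hc.image hf
  refine Set.Subset.antisymm ?_ ?_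
  · intro x hx
    obtain ⟨ι, _, z, w, hz, haff, hw, hw1, rfl⟩ := eq_pos_convex_span_of_mem_convexHull hx
    have hcard : Fintype.card ι ≤ Fintype.card (Fin n) := by
      rw [Fintype.card_fin]
      exact haff.card_le_finrank_succ.trans (Nat.succ_le_succ (Submodule.finrank_le _))
    obtain ⟨e⟩ := Function.Embedding.nonempty_of_card_le hcard
    refine ⟨(Function.extend e w 0, Function.extend e z fun _ => k₀), ⟨⟨?_, ?_⟩, ?_⟩, ?_⟩
    · intro i
      by_cases hi : ∃ j, e j = i
      · obtain ⟨j, rfl⟩ := hi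
        simpa [e.injective.extend_apply] using (hw j).le
      · simp [Function.extend_apply' _ _ _ hi]
    · rw [← hw1, ← Fintype.sum_of_injective e e.injective w (Function.extend e w 0)]
      · intro i hi
        exact Function.extend_apply' _ _ _ fun ⟨j, hj⟩ => hi ⟨j, hj⟩
      · intro j
        exact (e.injective.extend_apply w 0 j).symm
    · intro i _
      by_cases hi : ∃ j, e j = i
      · obtain ⟨j, rfl⟩ := hi
        simpa [e.injective.extend_apply] using hz ⟨j, rfl⟩
      · simpa [Function.extend_apply' _ _ _ hi] using hk₀
    · symm
      refine Fintype.sum_of_injective e e.injective _ _ ?_ ?_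
      · intro i hi
        have hi' : ¬ ∃ j, e j = i := fun ⟨j, hj⟩ => hi ⟨j, hj⟩
        simp [Function.extend_apply' _ _ _ hi']
      · intro j
        simp [e.injective.extend_apply]
  · rintro _ ⟨⟨w, z⟩, ⟨hw, hz⟩, rfl⟩
    exact mem_convexHull_of_exists_fintype w z hw.1 hw.2 (fun i => hz i (Set.mem_univ i)) rfl

theorem isCompact_setOf_isUnitVec (m : Type*) [Fintype m] :
    IsCompact {v : m → ℂ | IsUnitVec v} := by
  have hK : IsCompact (Set.pi Set.univ fun _ : m => Metric.closedBall (0 : ℂ) 1) :=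
    isCompact_univ_pi fun _ => isCompact_closedBall _ _
  refine hK.of_isClosed_subset ?_ ?_
  · refine isClosed_eq ?_ continuous_const
    simp only [dotProduct, Pi.star_apply]
    fun_prop
  · intro v hv i _
    have h : ∑ i, ‖v i‖ ^ 2 = 1 := by
      have h' : ((∑ i, ‖v i‖ ^ 2 : ℝ) : ℂ) = 1 := by
        rw [← (hv : star v ⬝ᵥ v = 1), dotProduct]
        push_cast
        refine Finset.sum_congr rfl fun i _ => ?_
        rw [Pi.star_apply, Complex.star_def, Complex.conj_mul']
      exact_mod_cast h'
    have h2 : ‖v i‖ ^ 2 ≤ 1 := h ▸ Finset.single_le_sum (f := fun i => ‖v i‖ ^ 2)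
      (fun _ _ => sq_nonneg _) (Finset.mem_univ i)
    simpa using (sq_le_one_iff₀ (norm_nonneg _)).1 h2

theorem IsUnitVec.single {m : Type*} [Fintype m] [DecidableEq m] (i : m) :
    IsUnitVec (Pi.single i (1 : ℂ)) := by
  simp [IsUnitVec]

theorem trace_proj {m : Type*} [Fintype m] {v : m → ℂ} (hv : IsUnitVec v) : (proj v).trace = 1 := by
  rw [proj, trace_vecMulVec, dotProduct_comm]
  exact hv

theorem continuous_proj {m : Type*} : Continuous (proj : (m → ℂ) → Matrix m m ℂ) := by
  refine continuous_matrix fun i j => ?_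
  simp only [proj, vecMulVec_apply, Pi.star_apply]
  fun_prop

theorem IsSeparable.of_fintype {A B ι : Type*} [Fintype A] [Fintype B] [Fintype ι] {p : ι → ℝ}
    {u : ι → A → ℂ} {v : ι → B → ℂ} (hp : ∀ i, 0 ≤ p i) (hu : ∀ i, IsUnitVec (u i))
    (hv : ∀ i, IsUnitVec (v i)) : IsSeparable (∑ i, p i • (proj (u i) ⊗ₖ proj (v i))) := by
  let e := (Fintype.equivFin ι).symm
  exact ⟨_, p ∘ e, u ∘ e, v ∘ e, fun i => hp _, fun i => hu _, fun i => hv _,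
    (Equiv.sum_comp e fun i => p i • (proj (u i) ⊗ₖ proj (v i))).symm⟩

theorem IsSeparable.add {A B : Type*} [Fintype A] [Fintype B] {X Y : Matrix (A × B) (A × B) ℂ}
    (hX : IsSeparable X) (hY : IsSeparable Y) : IsSeparable (X + Y) := by
  obtain ⟨n, p, u, v, hp, hu, hv, rfl⟩ := hX
  obtain ⟨n', p', u', v', hp', hu', hv', rfl⟩ := hY
  have := IsSeparable.of_fintype (ι := Fin n ⊕ Fin n') (p := Sum.elim p p') (u := Sum.elim u u')
    (v := Sum.elim v v') (by simpa using ⟨hp, hp'⟩) (by simpa using ⟨hu, hu'⟩)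
    (by simpa using ⟨hv, hv'⟩)
  simpa [Fintype.sum_sum_type] using this

theorem IsSeparable.smul {A B : Type*} [Fintype A] [Fintype B] {X : Matrix (A × B) (A × B) ℂ}
    {r : ℝ} (hr : 0 ≤ r) (hX : IsSeparable X) : IsSeparable (r • X) := by
  obtain ⟨n, p, u, v, hp, hu, hv, rfl⟩ := hX
  exact ⟨n, fun i => r * p i, u, v, fun i => mul_nonneg hr (hp i), hu, hv, by
    simp only [Finset.smul_sum, mul_smul]⟩

theorem convex_setOf_isSeparable (A B : Type*) [Fintype A] [Fintype B] :
    Convex ℝ {X : Matrix (A × B) (A × B) ℂ | IsSeparable X} :=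
  fun _ hX _ hY _ _ ha hb _ => (hX.smul ha).add (hY.smul hb)

/-- The spectral decomposition of `X` gives a separable decomposition of `X ⊗ |v⟩⟨v|`. -/
theorem isSeparable_kronecker_proj {A B : Type*} [Fintype A] [DecidableEq A] [Fintype B]
    {X : Matrix A A ℂ} (hX : X.PosSemidef) {v : B → ℂ} (hv : IsUnitVec v) :
    IsSeparable (X ⊗ₖ proj v) := by
  have hU : (hX.1.eigenvectorUnitary : Matrix A A ℂ)ᴴ *
      (hX.1.eigenvectorUnitary : Matrix A A ℂ) = 1 :=
    mem_unitaryGroup_iff'.1 hX.1.eigenvectorUnitary.2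
  have h := IsSeparable.of_fintype (p := hX.1.eigenvalues)
    (u := fun i a => (hX.1.eigenvectorUnitary : Matrix A A ℂ) a i) (v := fun _ => v)
    hX.eigenvalues_nonneg (fun i => ?_) fun _ => hv
  · convert h using 1
    ext ⟨a, b⟩ ⟨a', b'⟩
    conv_lhs => rw [kroneckerMap_apply, hX.1.spectral_theorem, Unitary.conjStarAlgAut_apply,
      Matrix.mul_apply]
    simp only [mul_diagonal, kroneckerMap_apply, Matrix.sum_apply, Matrix.smul_apply,
      Finset.sum_mul, proj, vecMulVec_apply, Pi.star_apply, Complex.real_smul, Function.comp_apply,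
      star_eq_conjTranspose, conjTranspose_apply, Complex.coe_algebraMap]
    exact Finset.sum_congr rfl fun i _ => by ring
  · have := congrFun (congrFun hU i) i
    rw [Matrix.mul_apply, Matrix.one_apply_eq] at this
    exact this

theorem trace_proj_kronecker_proj {A B : Type*} [Fintype A] [Fintype B] {u : A → ℂ} {v : B → ℂ}
    (hu : IsUnitVec u) (hv : IsUnitVec v) : (proj u ⊗ₖ proj v).trace = 1 := by
  rw [trace_kronecker, trace_proj hu, trace_proj hv, one_mul]

theorem sepStates_eq_convexHull (A B : Type*) [Fintype A] [Fintype B] :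
    sepStates A B = convexHull ℝ ((fun q : (A → ℂ) × (B → ℂ) => proj q.1 ⊗ₖ proj q.2) ''
      ({u | IsUnitVec u} ×ˢ {v | IsUnitVec v})) := by
  refine Set.Subset.antisymm ?_ (convexHull_min ?_ ?_)
  · rintro _ ⟨⟨n, p, u, v, hp, hu, hv, rfl⟩, htr⟩
    refine mem_convexHull_of_exists_fintype p _ hp ?_
      (fun i => ⟨(u i, v i), ⟨hu i, hv i⟩, rfl⟩) rfl
    simp only [trace_sum, trace_smul, trace_proj_kronecker_proj (hu _) (hv _), Complex.real_smul,
      mul_one] at htr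
    exact_mod_cast htr
  · rintro _ ⟨⟨u, v⟩, ⟨hu, hv⟩, rfl⟩
    refine ⟨?_, trace_proj_kronecker_proj hu hv⟩
    simpa using IsSeparable.of_fintype (ι := Unit) (p := fun _ => 1) (u := fun _ => u)
      (v := fun _ => v) (fun _ => zero_le_one) (fun _ => hu) fun _ => hv
  · intro X hX Y hY a b ha hb hab
    refine ⟨(hX.1.smul ha).add (hY.1.smul hb), ?_⟩
    rw [trace_add, trace_smul, trace_smul, hX.2, hY.2, Complex.real_smul, Complex.real_smul,
      mul_one, mul_one]
    exact_mod_cast hab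

theorem isCompact_sepStates (A B : Type*) [Fintype A] [Fintype B] : IsCompact (sepStates A B) := by
  rw [sepStates_eq_convexHull]
  refine isCompact_convexHull_of_isCompact
    (((isCompact_setOf_isUnitVec A).prod (isCompact_setOf_isUnitVec B)).image ?_)
  refine continuous_matrix fun i j => ?_
  simp only [kroneckerMap_apply]
  exact (((continuous_proj.comp continuous_fst).matrix_elem _ _).mul
    ((continuous_proj.comp continuous_snd).matrix_elem _ _))

theorem nonempty_sepStates (A B : Type*) [Fintype A] [Fintype B] [Nonempty A] [Nonempty B] :
    (sepStates A B).Nonempty := by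
  classical
  obtain ⟨a⟩ := ‹Nonempty A›
  obtain ⟨b⟩ := ‹Nonempty B›
  rw [sepStates_eq_convexHull, convexHull_nonempty_iff]
  exact ⟨_, (Pi.single a 1, Pi.single b 1), ⟨IsUnitVec.single a, IsUnitVec.single b⟩, rfl⟩

theorem isSeparable_iff {A B : Type*} [Fintype A] [Fintype B] [Nonempty A] [Nonempty B]
    {X : Matrix (A × B) (A × B) ℂ} :
    IsSeparable X ↔ 0 ≤ X.trace.re ∧ ∃ Y ∈ sepStates A B, X = X.trace.re • Y := by
  refine ⟨?_, fun ⟨h, Y, hY, hXY⟩ => hXY ▸ hY.1.smul h⟩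
  rintro ⟨n, p, u, v, hp, hu, hv, hX⟩
  have htr : X.trace = ((∑ i, p i : ℝ) : ℂ) := by
    simp only [hX, trace_sum, trace_smul, trace_proj_kronecker_proj (hu _) (hv _),
      Complex.real_smul, mul_one]
    push_cast
    rfl
  rw [htr, Complex.ofReal_re]
  have h0 : 0 ≤ ∑ i, p i := Finset.sum_nonneg fun i _ => hp i
  refine ⟨h0, ?_⟩
  obtain h | h := h0.eq_or_lt
  · obtain ⟨Y, hY⟩ := nonempty_sepStates A B
    refine ⟨Y, hY, ?_⟩
    have hp0 := (Finset.sum_eq_zero_iff_of_nonneg fun i _ => hp i).1 h.symm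
    rw [← h, zero_smul, hX]
    exact Finset.sum_eq_zero fun i hi => by rw [hp0 i hi, zero_smul]
  · have hsep : IsSeparable X := ⟨n, p, u, v, hp, hu, hv, hX⟩
    refine ⟨(∑ i, p i)⁻¹ • X, ⟨hsep.smul (inv_nonneg.2 h0), ?_⟩, ?_⟩
    · rw [trace_smul, htr, Complex.real_smul, ← Complex.ofReal_mul, inv_mul_cancel₀ h.ne',
        Complex.ofReal_one]
    · rw [smul_smul, mul_inv_cancel₀ h.ne', one_smul]

/-- The cone of separable operators is generated by the compact set of separable states, on which
the trace is one; it is therefore the projection of a closed set along a compact factor. -/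
theorem isClosed_setOf_isSeparable (A B : Type*) [Fintype A] [Fintype B] [Nonempty A]
    [Nonempty B] : IsClosed {X : Matrix (A × B) (A × B) ℂ | IsSeparable X} := by
  have hcomp : CompactSpace (sepStates A B) :=
    isCompact_iff_compactSpace.1 (isCompact_sepStates A B)
  have htr : Continuous fun X : Matrix (A × B) (A × B) ℂ => X.trace.re :=
    Complex.continuous_re.comp continuous_id.matrix_trace
  have hcl : IsClosed {q : Matrix (A × B) (A × B) ℂ × sepStates A B |
      q.1 = q.1.trace.re • (q.2 : Matrix (A × B) (A × B) ℂ)} :=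
    isClosed_eq continuous_fst
      ((htr.comp continuous_fst).smul (continuous_subtype_val.comp continuous_snd))
  have h := (isClosed_le (continuous_const (y := (0 : ℝ))) htr).inter
    (isClosedMap_fst_of_compactSpace _ hcl)
  convert h using 1
  ext X
  simp only [Set.mem_ofPred_eq, Set.mem_inter_iff, isSeparable_iff, Set.mem_image, Prod.exists,
    Subtype.exists, exists_and_right, exists_eq_right, exists_prop]

/-- The integral of a continuous family of separable operators is separable. -/
theorem isSeparable_integral {A B Ω : Type*} [Fintype A] [Fintype B] [Nonempty A] [Nonempty B]
    [MeasurableSpace Ω] {μ : Measure Ω} [IsProbabilityMeasure μ]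
    {f : Ω → Matrix (A × B) (A × B) ℂ} (hf : ∀ i j, Integrable (fun ω => f ω i j) μ)
    (hsep : ∀ ω, IsSeparable (f ω)) : IsSeparable (of fun i j => ∫ ω, f ω i j ∂μ) := by
  let g : Ω → A × B → A × B → ℂ := f
  have hg (i : A × B) : Integrable (fun ω => g ω i) μ := Integrable.of_eval (hf i)
  have hcv : Convex ℝ {X : A × B → A × B → ℂ | IsSeparable X} := convex_setOf_isSeparable A B
  have hcl : IsClosed {X : A × B → A × B → ℂ | IsSeparable X} := isClosed_setOf_isSeparable A B
  have h := hcv.integral_mem (μ := μ) (f := g) hcl (Filter.Eventually.of_forall hsep)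
    (Integrable.of_eval hg)
  have heq : (∫ ω, g ω ∂μ) = fun i j => ∫ ω, f ω i j ∂μ := by
    funext i j
    rw [eval_integral hg, eval_integral (hf i)]
  rw [heq] at h
  exact h

end BoseExt

/-! ### Separability of the noisy operator and the critical probability -/

namespace BoseExt

/-- The measure-and-prepare decomposition is an integral of separable operators. -/
theorem isSeparable_noisy {A B : Type*} [Fintype A] [DecidableEq A] [Nonempty A] [Fintype B]
    [DecidableEq B] [Nonempty B] {N : ℕ} [NeZero N] {Λ : Matrix (A × B) (A × B) ℂ}
    (hΛ : Λ ∈ extendible A B N) : IsSeparable (noisy N Λ) := by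
  obtain ⟨-, Ω, hΩ⟩ := hΛ
  have b₀ : B := Classical.arbitrary B
  have hφ : IsUnitVec (Pi.single b₀ (1 : ℂ)) := IsUnitVec.single b₀
  have h := isSeparable_integral (μ := haarUnitary B)
    (f := fun U => postMeasure (haarPOVM N (Pi.single b₀ 1) U) Ω ⊗ₖ proj (ketU (Pi.single b₀ 1) U))
    (fun i j => integrable_haarUnitary
      ((continuous_postMeasure_kronecker_proj N _ Ω).matrix_elem i j))
    fun U => isSeparable_kronecker_proj
      (postMeasure_posSemidef (Nat.cast_nonneg _) _ hΩ.posSemidef) (isUnitVec_ketU hφ U)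
  convert h using 1
  ext i j
  exact (integral_postMeasure_kronecker_proj hφ hΩ i j).symm

theorem applyRight_depolarize_eq_noisy {A B : Type*} [Fintype B] [DecidableEq B]
    [Nonempty B] (N : ℕ) (Λ : Matrix (A × B) (A × B) ℂ) :
    applyRight (depolarize ((Fintype.card B : ℝ) / (N + Fintype.card B))) Λ = noisy N Λ := by
  have hd : (Fintype.card B : ℂ) ≠ 0 := Nat.cast_ne_zero.2 Fintype.card_ne_zero
  have hNd : (N : ℂ) + Fintype.card B ≠ 0 := by
    have : N + Fintype.card B ≠ 0 := by
      have := Fintype.card_ne_zero (α := B)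
      omega
    exact_mod_cast this
  ext i j
  have htr : (block Λ i.1 j.1).trace = ptraceRight Λ i.1 j.1 := rfl
  have hb : block Λ i.1 j.1 i.2 j.2 = Λ i j := rfl
  simp only [applyRight, depolarize, noisy, of_apply, Matrix.add_apply, Matrix.smul_apply,
    kroneckerMap_apply, htr, hb, Complex.real_smul, smul_eq_mul]
  push_cast
  field_simp
  ring

theorem trace_noisy {A B : Type*} [Fintype A] [Fintype B] [DecidableEq B] [Nonempty B] (N : ℕ)
    (Λ : Matrix (A × B) (A × B) ℂ) : (noisy N Λ).trace = Λ.trace := by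
  have htr : (ptraceRight Λ).trace = Λ.trace := by
    simp [Matrix.trace, ptraceRight, Fintype.sum_prod_type]
  have hNd : (N : ℂ) + Fintype.card B ≠ 0 := by
    have : N + Fintype.card B ≠ 0 := by
      have := Fintype.card_ne_zero (α := B)
      omega
    exact_mod_cast this
  rw [noisy, trace_add, trace_smul, trace_smul, trace_kronecker, trace_one, htr]
  simp only [Complex.real_smul]
  push_cast
  field_simp

theorem mem_disentanglingProbs {A B : Type*} [Fintype A] [DecidableEq A] [Nonempty A] [Fintype B]
    [DecidableEq B] [Nonempty B] {N : ℕ} [NeZero N] {ρ : Matrix (A × B) (A × B) ℂ}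
    (hρ : ρ ∈ extendibleStates A B N) :
    (Fintype.card B : ℝ) / (N + Fintype.card B) ∈ disentanglingProbs ρ := by
  refine ⟨by positivity, ?_, ?_, ?_⟩
  · exact div_le_one_of_le₀ (le_add_of_nonneg_left (Nat.cast_nonneg _)) (by positivity)
  · rw [applyRight_depolarize_eq_noisy]
    exact isSeparable_noisy hρ.1
  · rw [applyRight_depolarize_eq_noisy, trace_noisy]
    exact hρ.2

theorem bddBelow_disentanglingProbs {A B : Type*} [Fintype A] [Fintype B] [DecidableEq B]
    (ρ : Matrix (A × B) (A × B) ℂ) : BddBelow (disentanglingProbs ρ) :=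
  ⟨0, fun _ hp => hp.1⟩

theorem isClosed_disentanglingProbs {A B : Type*} [Fintype A] [Fintype B] [DecidableEq B]
    (ρ : Matrix (A × B) (A × B) ℂ) : IsClosed (disentanglingProbs ρ) := by
  have hcont : Continuous fun p : ℝ => applyRight (depolarize p) ρ := by
    refine continuous_matrix fun i j => ?_
    simp only [applyRight, depolarize, of_apply, Matrix.add_apply, Matrix.smul_apply]
    fun_prop
  exact isClosed_Ici.inter (isClosed_Iic.inter ((isCompact_sepStates A B).isClosed.preimage hcont))

/-- A pure product state has the corresponding pure product state as an extension. -/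
theorem nonempty_extendibleStates (A B : Type*) [Fintype A] [DecidableEq A] [Nonempty A]
    [Fintype B] [DecidableEq B] [Nonempty B] (N : ℕ) [NeZero N] :
    (extendibleStates A B N).Nonempty := by
  obtain ⟨a₀⟩ := ‹Nonempty A›
  obtain ⟨b₀⟩ := ‹Nonempty B›
  have hP (y : Fin N → B) : symProj B N (fun _ => b₀) y = if y = fun _ => b₀ then 1 else 0 := by
    have hc (π : Equiv.Perm (Fin N)) : (fun _ : Fin N => b₀) ∘ π = fun _ => b₀ := rfl
    simp only [symProj_apply, hc, Finset.sum_const, Finset.card_univ, Fintype.card_perm,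
      Fintype.card_fin, nsmul_eq_mul]
    rw [inv_mul_cancel_left₀ (Nat.cast_ne_zero.2 N.factorial_ne_zero)]
    exact if_congr eq_comm rfl rfl
  refine ⟨proj (Pi.single (a₀, b₀) 1), ⟨proj_posSemidef _, proj (Pi.single (a₀, fun _ => b₀) 1),
    proj_posSemidef _, ?_, ?_⟩, trace_proj (IsUnitVec.single _)⟩
  · ext ⟨a, b⟩ ⟨a', b'⟩
    simp only [reduceFirst, of_apply, proj, vecMulVec_apply, Pi.star_apply]
    rw [Finset.sum_eq_single (fun _ => b₀) (fun x _ hx => ?_) (by simp)]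
    · have hu : Function.update (fun _ : Fin N => b₀) 0 b' = (fun _ => b₀) ↔ b' = b₀ := by
        rw [Function.update_eq_iff]
        simp
      simp only [Pi.single_apply, Prod.mk.injEq, hu, and_true]
      by_cases h : b = b₀
      · simp [h]
      · simp [h, Ne.symm h]
    · simp [Pi.single_apply, hx]
  · ext ⟨a, x⟩ ⟨a', x'⟩
    simp only [Matrix.mul_apply, proj, vecMulVec_apply, Pi.star_apply, kroneckerMap_apply]
    rw [Finset.sum_eq_single (a₀, fun _ => b₀) (fun k _ hk => ?_) (by simp)]
    · rw [hP]
      by_cases ha : a' = a₀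
      · subst ha
        by_cases hx : x' = fun _ => b₀ <;> simp [hx, Pi.single_apply]
      · simp [Ne.symm ha, ha, Pi.single_apply]
    · simp [Pi.single_apply, hk]

end BoseExt

theorem theorem1 {A B : Type*} [Fintype A] [DecidableEq A] [Nonempty A]
    [Fintype B] [DecidableEq B] [Nonempty B] (N : ℕ) [NeZero N] :
    -- The minimum and the supremum in the definition of the critical probability make sense,
    -- and the critical probability of the `N`-extendible states is at most `d / (N + d)`.
    ((∀ ρ ∈ BoseExt.extendibleStates A B N,
        IsLeast (BoseExt.disentanglingProbs ρ) (BoseExt.criticalProb ρ)) ∧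
      IsLUB (BoseExt.criticalProb '' BoseExt.extendibleStates A B N)
        (BoseExt.criticalProbSet (BoseExt.extendibleStates A B N)) ∧
      BoseExt.criticalProbSet (BoseExt.extendibleStates A B N) ≤
        (Fintype.card B : ℝ) / (N + Fintype.card B)) ∧
    -- For every `N`-extendible operator the noisy operator is separable.
    (∀ Λ ∈ BoseExt.extendible A B N, BoseExt.IsSeparable (BoseExt.noisy N Λ)) ∧
    -- The decomposition: the Haar-random measurement is complete on the symmetric subspace,
    -- and measuring it and preparing `|U⟩` yields the noisy operator.
    (∀ φ : B → ℂ, BoseExt.IsUnitVec φ →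
      (∀ U, (BoseExt.haarPOVM N φ U).PosSemidef) ∧
      (∀ x y, Integrable (fun U => BoseExt.haarPOVM N φ U x y) (BoseExt.haarUnitary B) ∧
        ∫ U, BoseExt.haarPOVM N φ U x y ∂(BoseExt.haarUnitary B) = BoseExt.symProj B N x y) ∧
      ∀ Λ Ω, BoseExt.IsBSE (A := A) N Λ Ω →
        (∀ U, (BoseExt.postMeasure (BoseExt.haarPOVM N φ U) Ω).PosSemidef) ∧
        ∀ i j, Integrable (fun U => (BoseExt.postMeasure (BoseExt.haarPOVM N φ U) Ω ⊗ₖ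
            BoseExt.proj (BoseExt.ketU φ U)) i j) (BoseExt.haarUnitary B) ∧
          BoseExt.noisy N Λ i j =
            ∫ U, (BoseExt.postMeasure (BoseExt.haarPOVM N φ U) Ω ⊗ₖ
              BoseExt.proj (BoseExt.ketU φ U)) i j ∂(BoseExt.haarUnitary B)) := by
  have hle : ∀ p ∈ BoseExt.criticalProb '' BoseExt.extendibleStates A B N,
      p ≤ (Fintype.card B : ℝ) / (N + Fintype.card B) := by
    rintro _ ⟨ρ, hρ, rfl⟩
    exact csInf_le (BoseExt.bddBelow_disentanglingProbs ρ) (BoseExt.mem_disentanglingProbs hρ)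
  have hne := (BoseExt.nonempty_extendibleStates A B N).image BoseExt.criticalProb
  refine ⟨⟨fun ρ hρ => ?_, isLUB_csSup hne ⟨_, hle⟩, csSup_le hne hle⟩,
    fun Λ hΛ => BoseExt.isSeparable_noisy hΛ, fun φ hφ =>
      ⟨BoseExt.haarPOVM_posSemidef N φ, fun x y => ?_, fun Λ Ω hΩ => ⟨fun U => ?_, fun i j =>
        ⟨?_, (BoseExt.integral_postMeasure_kronecker_proj hφ hΩ i j).symm⟩⟩⟩⟩
  · exact (BoseExt.isClosed_disentanglingProbs ρ).isLeast_csInf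
      ⟨_, BoseExt.mem_disentanglingProbs hρ⟩ (BoseExt.bddBelow_disentanglingProbs ρ)
  · refine ⟨(BoseExt.integrable_haarUnitary
      (BoseExt.continuous_proj_tensorPow_ketU N φ x y)).const_mul _, ?_⟩
    exact (integral_const_mul _ _).trans (BoseExt.choose_mul_haarMoment N hφ x y)
  · exact BoseExt.postMeasure_posSemidef (Nat.cast_nonneg _) _ hΩ.posSemidef
  · exact BoseExt.integrable_haarUnitary
      ((BoseExt.continuous_postMeasure_kronecker_proj N φ Ω).matrix_elem i j)
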